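/- Consider an $n\times n\times n$ cube of lights, each of which is on or off. There are $3n$ plane switches: for each $i$, the $i$-th $X$-plane switch flips (on $\leftrightarrow$ off) all lights $(i,\cdot,\cdot)$; for each $j$, the $j$-th $Y$-plane switch flips all lights $(\cdot,j,\cdot)$; for each $k$, the $k$-th $Z$-plane switch flips all lights $(\cdot,\cdot,k)$. The imbalance of a state of the cube is the absolute value of the difference between the number of lights that are on and the number of lights that are off. Let $P_n$ be the minimum value such that, from every initial state of the $n\times n\times n$ cube, some choice of plane switches reduces the imbalance to at most $P_n$. Then $P_4=4$: from every initial state of the $4\times 4\times 4$ cube one can reach imbalance at most $4$ by plane switches, and $4$ cannot be replaced by any smaller value. -/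

import Mathlib

/-- A state of the `n × n × n` cube of lights: the light at `(i, j, k)` is on if its value
is `1` and off if its value is `-1` (the only two units of `ℤ`). -/
abbrev LightCube (n : ℕ) : Type := Fin n → Fin n → Fin n → ℤˣ

/-- The number of lights of the cube that are in the state `s`. -/
def LightCube.count {n : ℕ} (A : LightCube n) (s : ℤˣ) : ℕ :=
  (Finset.univ.filter fun p : Fin n × Fin n × Fin n => A p.1 p.2.1 p.2.2 = s).card

/-- The imbalance: the absolute difference between the number of lights that are on and
the number of lights that are off. -/
def LightCube.imbalance {n : ℕ} (A : LightCube n) : ℕ :=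
  ((A.count 1 : ℤ) - (A.count (-1) : ℤ)).natAbs

/-- The state after throwing plane switches: `x i = -1` means that the switch of the `i`-th
`X`-plane, which flips all lights `(i, j, k)` with this `i`, is thrown, and `x i = 1` that it
is not; similarly for `y j` and the `Y`-planes, and for `z k` and the `Z`-planes. -/
def LightCube.switch {n : ℕ} (A : LightCube n) (x y z : Fin n → ℤˣ) : LightCube n :=
  fun i j k => x i * y j * z k * A i j k

/-- From every initial state of the `n × n × n` cube, plane switches can reduce the imbalance
to at most `p`. -/
def AlwaysReducible (n p : ℕ) : Prop :=
  ∀ A : LightCube n, ∃ x y z : Fin n → ℤˣ, (A.switch x y z).imbalance ≤ p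

/-- `minThreshold n` is `P_n`: the minimum `p` such that from every initial state of the
`n × n × n` cube, plane switches can reduce the imbalance to at most `p`. -/
noncomputable def minThreshold (n : ℕ) : ℕ := sInf {p : ℕ | AlwaysReducible n p}

/-- The imbalance is the absolute value of the sum of all the values `±1`. -/
theorem LightCube.imbalance_eq {n : ℕ} (A : LightCube n) :
    A.imbalance = (∑ i, ∑ j, ∑ k, (A i j k : ℤ)).natAbs := by
  have h : (∑ i, ∑ j, ∑ k, (A i j k : ℤ)) = (A.count 1 : ℤ) - (A.count (-1) : ℤ) := by
    simp only [LightCube.count, Finset.card_filter, Nat.cast_sum, ← Finset.sum_sub_distrib,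
      Fintype.sum_prod_type]
    refine Finset.sum_congr rfl fun i _ => Finset.sum_congr rfl fun j _ =>
      Finset.sum_congr rfl fun k _ => ?_
    rcases Int.units_eq_one_or (A i j k) with h | h <;> rw [h] <;> decide
  rw [LightCube.imbalance, h]

/-- The minimum in the definition of `P_n` is attained: the set of admissible `p` is not empty. -/
theorem minThreshold_isLeast (n : ℕ) : IsLeast {p : ℕ | AlwaysReducible n p} (minThreshold n) := by
  have hne : {p : ℕ | AlwaysReducible n p}.Nonempty := by
    refine ⟨Finset.univ.sup fun A : LightCube n => A.imbalance, fun A => ⟨1, 1, 1, ?_⟩⟩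
    exact Finset.le_sup (f := fun A : LightCube n => A.imbalance) (Finset.mem_univ _)
  exact ⟨Nat.sInf_mem hne, fun p hp => Nat.sInf_le hp⟩

/-!
Write the total after switching as `∑ x i * y j * z k * A i j k`, a sum of signs.

*Four is enough.* For fixed `z` let `N i j` be half of the line sum `∑ k, z k * A i j k`, an
integer between `-2` and `2`. It is odd exactly when `∏ z` and `∏ k, A i j k` differ, so for one of
the two values `δ` of `∏ z` at least half of the 16 entries of `N` are odd. The sign vectors with
`∏ z = δ` are, up to a global sign, an orthogonal basis of `ℝ⁴`, so `∑ (N i j) ^ 2` averages to 16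
over them, and some such `z` has `∑ (N i j) ^ 2 ≤ 16` (`exists_half_lineSums`). What remains is a
statement about matrices (`exists_signs_abs_le_two`): such an `N` has `|∑ x i * y j * N i j| ≤ 2`
for suitable signs.

If not, then for no `y` can the row sums `r i = ∑ j, y j * N i j` be balanced by signs to absolute
value at most 2, while `∑ (r i) ^ 2` has mean `∑ (N i j) ^ 2 ≤ 16` over `y`.
* If `∑ N i j` is even, an unbalanceable `r` has `∑ (r i) ^ 2 ≥ 16`, with equality only for
  `(±4, 0, 0, 0)` up to order. Hence all row sums are divisible by 4 for every `y`, and changing one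
  sign of `y` shows that every entry of `N` is even, a contradiction.
* If `∑ N i j` is odd, then `∑ (N i j) ^ 2 ≤ 15`, and a `y` with `∑ (r i) ^ 2 ≤ 15` shows that
  exactly one row, say `i₀`, has an odd sum. An unbalanceable `r` then has
  `8 * |r i₀| + ∑_{i ≠ i₀} (r i) ^ 2 ≥ 24`, and even `≥ 44` if `r i` is not divisible by 4 for some
  `i ≠ i₀`. The total of this quantity over the 8 vectors `y` (up to sign) is at most
  `208 < 8 * 24 + 20`, so again all entries outside row `i₀` are even, a contradiction.

*Three is not enough.* Turn off the six lights of a set meeting every plane in 0 or 2 lights. The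
total is `(∑ x) * (∑ y) * (∑ z) - 2 * S`, where the product is divisible by 8, and `S` is a sum of
six signs whose product is 1, so `S` is `2` modulo 4. The total is thus `4` modulo 8, for all
switches.
-/

namespace LightCube

/-- The sign vectors of length 4 with first entry `1`: one from each pair `{v, -v}`. -/
def signs (p : ℤˣ × ℤˣ × ℤˣ) : Fin 4 → ℤˣ := ![1, p.1, p.2.1, p.2.2]

/-- The sum of `v` with the signs `signs p`. -/
def signedSum (p : ℤˣ × ℤˣ × ℤˣ) (v : Fin 4 → ℤ) : ℤ := ∑ j, (signs p j : ℤ) * v j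

/-- Four integers are balanceable if some choice of signs makes their sum at most 2 in absolute
value. -/
def Balanceable (r : Fin 4 → ℤ) : Prop := ∃ p, |signedSum p r| ≤ 2

theorem signedSum_eq (p : ℤˣ × ℤˣ × ℤˣ) (v : Fin 4 → ℤ) :
    signedSum p v = v 0 + p.1 * v 1 + p.2.1 * v 2 + p.2.2 * v 3 := by
  simp [signedSum, signs, Fin.sum_univ_four]

theorem sum_units (f : ℤˣ → ℤ) : ∑ s, f s = f 1 + f (-1) := by
  rw [UnitsInt.univ, Finset.sum_pair (by decide)]

theorem sum_signedSum_sq (v : Fin 4 → ℤ) :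
    ∑ p, signedSum p v ^ 2 = 8 * ∑ j, v j ^ 2 := by
  simp only [signedSum_eq, Fintype.sum_prod_type, sum_units, Fin.sum_univ_four]
  push_cast
  ring

theorem even_signedSum_iff (p : ℤˣ × ℤˣ × ℤˣ) (v : Fin 4 → ℤ) :
    Even (signedSum p v) ↔ Even (∑ j, v j) := by
  obtain ⟨a, b, c⟩ := p
  simp only [signedSum_eq, Fin.sum_univ_four]
  rcases Int.units_eq_one_or a with rfl | rfl <;> rcases Int.units_eq_one_or b with rfl | rfl <;>
    rcases Int.units_eq_one_or c with rfl | rfl <;> simp [Int.even_add]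

/-- Changing one sign changes the signed sum by twice an entry. -/
theorem even_of_four_dvd_signedSum {v : Fin 4 → ℤ} (h : ∀ p, 4 ∣ signedSum p v) (j : Fin 4) :
    Even (v j) := by
  have h₀ := h (1, 1, 1)
  have h₁ := h (-1, 1, 1)
  have h₂ := h (1, -1, 1)
  have h₃ := h (1, 1, -1)
  have h₄ := h (-1, -1, -1)
  simp only [signedSum_eq, Units.val_one, Units.val_neg] at h₀ h₁ h₂ h₃ h₄
  rw [Int.even_iff]
  fin_cases j <;> simp <;> omega

/-- Cauchy–Schwarz is too weak here, as equality holds for `(0, 0, 1, 2)`; the finitely many `v`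
are checked. -/
theorem sum_abs_signedSum_le {v : Fin 4 → ℤ} (hv : ∀ j, |v j| ≤ 2) (ho : Odd (∑ j, v j)) :
    ∑ p, |signedSum p v| ≤ 11 + ∑ j, v j ^ 2 := by
  have key : ∀ a ∈ Finset.Icc (-2 : ℤ) 2, ∀ b ∈ Finset.Icc (-2 : ℤ) 2,
      ∀ c ∈ Finset.Icc (-2 : ℤ) 2, ∀ d ∈ Finset.Icc (-2 : ℤ) 2, (a + b + c + d) % 2 = 1 →
      |a + b + c + d| + |a + b + c - d| + (|a + b - c + d| + |a + b - c - d|) +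
        (|a - b + c + d| + |a - b + c - d| + (|a - b - c + d| + |a - b - c - d|)) ≤
      11 + (a * a + b * b + c * c + d * d) := by decide +kernel
  have hm := fun j => Finset.mem_Icc.2 (abs_le.1 (hv j))
  have := key _ (hm 0) _ (hm 1) _ (hm 2) _ (hm 3)
    (by simpa [Fin.sum_univ_four] using Int.odd_iff.1 ho)
  simp only [signedSum_eq, Fintype.sum_prod_type, sum_units, Fin.sum_univ_four]
  convert this using 2 <;> simp [sub_eq_add_neg, pow_two]

theorem abs_le_of_sum_sq_lt {r : Fin 4 → ℤ} {m : ℤ} (hm : 0 ≤ m)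
    (h : ∑ i, r i ^ 2 < (m + 1) ^ 2) (i : Fin 4) : r i ∈ Finset.Icc (-m) m := by
  have h₁ : r i ^ 2 ≤ ∑ i, r i ^ 2 :=
    Finset.single_le_sum (f := fun i => r i ^ 2) (fun i _ => sq_nonneg _) (Finset.mem_univ i)
  have := abs_lt_of_sq_lt_sq (h₁.trans_lt h) (by omega)
  rw [Finset.mem_Icc, ← abs_le]
  omega

/-- The unbalanceable vectors with even sum and smallest norm are `(±4, 0, 0, 0)` up to order. -/
theorem of_not_balanceable_even {r : Fin 4 → ℤ} (hr : ¬ Balanceable r) (he : Even (∑ i, r i))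
    (hs : ∑ i, r i ^ 2 ≤ 16) : ∑ i, r i ^ 2 = 16 ∧ ∀ i, 4 ∣ r i := by
  have key : ∀ a ∈ Finset.Icc (-4 : ℤ) 4, ∀ b ∈ Finset.Icc (-4 : ℤ) 4,
      ∀ c ∈ Finset.Icc (-4 : ℤ) 4, ∀ d ∈ Finset.Icc (-4 : ℤ) 4,
      a * a + b * b + c * c + d * d ≤ 16 → (a + b + c + d) % 2 = 0 →
      (¬ ∃ s t u : ℤˣ, |a + s * b + t * c + u * d| ≤ 2) →
      a * a + b * b + c * c + d * d = 16 ∧ 4 ∣ a ∧ 4 ∣ b ∧ 4 ∣ c ∧ 4 ∣ d := by decide +kernel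
  have hm := abs_le_of_sum_sq_lt (r := r) (m := 4) (by norm_num) (by omega)
  simp only [Balanceable, signedSum_eq, Prod.exists] at hr
  simp only [Fin.sum_univ_four, pow_two, Int.even_iff] at hs he ⊢
  have := key _ (hm 0) _ (hm 1) _ (hm 2) _ (hm 3) hs he hr
  simpa [Fin.forall_fin_succ] using this

/-- The only unbalanceable vectors with odd sum and norm at most 15 are `(±3, 0, 0, 0)` up to
order. -/
theorem exists_odd_of_not_balanceable {r : Fin 4 → ℤ} (hr : ¬ Balanceable r)
    (ho : Odd (∑ i, r i)) (hs : ∑ i, r i ^ 2 ≤ 15) :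
    ∃ i₀, Odd (r i₀) ∧ ∀ i, i ≠ i₀ → Even (r i) := by
  have key : ∀ a ∈ Finset.Icc (-3 : ℤ) 3, ∀ b ∈ Finset.Icc (-3 : ℤ) 3,
      ∀ c ∈ Finset.Icc (-3 : ℤ) 3, ∀ d ∈ Finset.Icc (-3 : ℤ) 3,
      a * a + b * b + c * c + d * d ≤ 15 → (a + b + c + d) % 2 = 1 →
      (¬ ∃ s t u : ℤˣ, |a + s * b + t * c + u * d| ≤ 2) →
      a % 2 + b % 2 + c % 2 + d % 2 = 1 := by decide +kernel
  have hm := abs_le_of_sum_sq_lt (r := r) (m := 3) (by norm_num) (by omega)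
  simp only [Balanceable, signedSum_eq, Prod.exists] at hr
  simp only [Fin.sum_univ_four, pow_two, Int.odd_iff] at hs ho
  have := key _ (hm 0) _ (hm 1) _ (hm 2) _ (hm 3) hs ho hr
  simp only [Fin.exists_fin_succ, Fin.forall_fin_succ, Int.odd_iff, Int.even_iff]
  simp
  omega

theorem Balanceable.of_comp_equiv {r : Fin 4 → ℤ} (σ : Equiv.Perm (Fin 4))
    (h : Balanceable (r ∘ σ)) : Balanceable r := by
  obtain ⟨p, hp⟩ := h
  set x : Fin 4 → ℤˣ := fun i => signs p (σ.symm i) with hx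
  -- normalise the transported sign vector to have first entry `1`
  refine ⟨(x 0 * x 1, x 0 * x 2, x 0 * x 3), ?_⟩
  have h₁ : signedSum (x 0 * x 1, x 0 * x 2, x 0 * x 3) r = x 0 * signedSum p (r ∘ σ) := by
    have h₂ : signedSum p (r ∘ σ) = ∑ i, (x i : ℤ) * r i := by
      rw [← Equiv.sum_comp σ]
      simp [hx, signedSum]
    have h₃ : (x 0 : ℤ) * x 0 = 1 := by simp
    rw [h₂, signedSum_eq, Fin.sum_univ_four]
    push_cast
    linear_combination -(r 0) * h₃
  rw [h₁, abs_mul, Int.abs_eq_natAbs (x 0 : ℤ), Int.units_natAbs]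
  simpa using hp

/-- If exactly the entry `r i₀` is odd, then unbalanceability forces the other entries to be large,
in particular when they are not all divisible by 4. -/
theorem of_not_balanceable_odd {r : Fin 4 → ℤ} {i₀ : Fin 4} (hr : ¬ Balanceable r)
    (ho : Odd (r i₀)) (he : ∀ i, i ≠ i₀ → Even (r i)) :
    24 ≤ 8 * |r i₀| + ∑ i ∈ Finset.univ.erase i₀, r i ^ 2 ∧
      (8 * |r i₀| + ∑ i ∈ Finset.univ.erase i₀, r i ^ 2 < 44 → ∀ i, i ≠ i₀ → 4 ∣ r i) := by
  have key : ∀ a ∈ Finset.Icc (-3 : ℤ) 2, ∀ b ∈ Finset.Icc (-3 : ℤ) 3,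
      ∀ c ∈ Finset.Icc (-3 : ℤ) 3, ∀ d ∈ Finset.Icc (-3 : ℤ) 3,
      8 * |2 * a + 1| + 4 * (b * b + c * c + d * d) < 44 →
      (¬ ∃ s t u : ℤˣ, |(2 * a + 1) + s * (2 * b) + t * (2 * c) + u * (2 * d)| ≤ 2) →
      24 ≤ 8 * |2 * a + 1| + 4 * (b * b + c * c + d * d) ∧
        b % 2 = 0 ∧ c % 2 = 0 ∧ d % 2 = 0 := by decide +kernel
  set σ : Equiv.Perm (Fin 4) := Equiv.swap 0 i₀ with hσ
  have hσ₀ : σ 0 = i₀ := by simp [hσ]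
  have hne : ∀ i, i ≠ 0 → σ i ≠ i₀ := fun i hi h => hi (σ.injective (h.trans hσ₀.symm))
  have hsum : ∑ i ∈ Finset.univ.erase i₀, r i ^ 2 = r (σ 1) ^ 2 + r (σ 2) ^ 2 + r (σ 3) ^ 2 := by
    have h₁ := Finset.add_sum_erase Finset.univ (fun i => r i ^ 2) (Finset.mem_univ i₀)
    have h₂ := Equiv.sum_comp σ (fun i => r i ^ 2)
    rw [Fin.sum_univ_four, hσ₀] at h₂
    linarith
  suffices h : 8 * |r i₀| + ∑ i ∈ Finset.univ.erase i₀, r i ^ 2 < 44 →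
      24 ≤ 8 * |r i₀| + ∑ i ∈ Finset.univ.erase i₀, r i ^ 2 ∧ ∀ i, i ≠ i₀ → 4 ∣ r i by
    refine ⟨?_, fun h' => (h h').2⟩
    by_contra hlt
    exact hlt (h (by omega)).1
  rw [hsum]
  intro hlt
  have hr' : ¬ Balanceable (r ∘ σ) := fun h => hr (h.of_comp_equiv σ)
  simp only [Balanceable, signedSum_eq, Prod.exists, Function.comp_apply, hσ₀] at hr'
  obtain ⟨a, ha⟩ := ho
  obtain ⟨b, hb⟩ := (he _ (hne 1 (by decide))).two_dvd
  obtain ⟨c, hc⟩ := (he _ (hne 2 (by decide))).two_dvd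
  obtain ⟨d, hd⟩ := (he _ (hne 3 (by decide))).two_dvd
  rw [ha, hb, hc, hd] at hr' hlt ⊢
  have hA : |2 * a + 1| < 6 := by nlinarith [sq_nonneg b, sq_nonneg c, sq_nonneg d]
  have hA' := abs_lt.1 hA
  have h0 := abs_nonneg (2 * a + 1)
  have := key a (Finset.mem_Icc.2 (by omega))
    b (Finset.mem_Icc.2 (by constructor <;> nlinarith [sq_nonneg c, sq_nonneg d]))
    c (Finset.mem_Icc.2 (by constructor <;> nlinarith [sq_nonneg b, sq_nonneg d]))
    d (Finset.mem_Icc.2 (by constructor <;> nlinarith [sq_nonneg b, sq_nonneg c]))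
    (by linarith) hr'
  obtain ⟨h24, hb2, hc2, hd2⟩ := this
  refine ⟨by linarith, fun i hi => ?_⟩
  obtain ⟨k, rfl⟩ := σ.surjective i
  have : k ≠ 0 := by rintro rfl; exact hi hσ₀
  fin_cases k
  · exact absurd rfl this
  · change 4 ∣ r (σ 1); omega
  · change 4 ∣ r (σ 2); omega
  · change 4 ∣ r (σ 3); omega

theorem even_sum_iff_of_even_iff {ι : Type*} {s : Finset ι} {f g : ι → ℤ}
    (h : ∀ i ∈ s, (Even (f i) ↔ Even (g i))) : Even (∑ i ∈ s, f i) ↔ Even (∑ i ∈ s, g i) := by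
  have : Even (∑ i ∈ s, (f i - g i)) :=
    Finset.even_sum _ fun i hi => Int.even_sub.2 (h i hi)
  rwa [Finset.sum_sub_distrib, Int.even_sub] at this

/-- A small matrix with many odd entries can be balanced by signs of its rows and columns. -/
theorem exists_signs_abs_le_two (N : Fin 4 → Fin 4 → ℤ) (hN : ∀ i j, |N i j| ≤ 2)
    (hodd : 8 ≤ (Finset.univ.filter fun q : Fin 4 × Fin 4 => Odd (N q.1 q.2)).card)
    (hsq : ∑ i, ∑ j, N i j ^ 2 ≤ 16) :
    ∃ p q, |signedSum p fun i => signedSum q (N i)| ≤ 2 := by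
  by_contra hcon
  have hbad : ∀ q, ¬ Balanceable fun i => signedSum q (N i) := fun q ⟨p, hp⟩ => hcon ⟨p, q, hp⟩
  have htot : ∑ q, ∑ i, signedSum q (N i) ^ 2 = 8 * ∑ i, ∑ j, N i j ^ 2 := by
    rw [Finset.sum_comm, Finset.mul_sum]
    exact Finset.sum_congr rfl fun i _ => sum_signedSum_sq (N i)
  have hpar : ∀ q, Even (∑ i, signedSum q (N i)) ↔ Even (∑ i, ∑ j, N i j) := fun q =>
    even_sum_iff_of_even_iff fun i _ => even_signedSum_iff q (N i)
  have hcard : (Finset.univ : Finset (ℤˣ × ℤˣ × ℤˣ)).card = 8 := by decide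
  rcases Int.even_or_odd (∑ i, ∑ j, N i j) with he | ho
  · have hmin : ∀ q, 16 ≤ ∑ i, signedSum q (N i) ^ 2 := fun q => by
      by_contra hlt
      have := (of_not_balanceable_even (hbad q) ((hpar q).2 he) (by omega)).1
      omega
    have hle : ∀ q, ∑ i, signedSum q (N i) ^ 2 ≤ 16 := fun q => by
      by_contra hlt
      have : ∑ q : ℤˣ × ℤˣ × ℤˣ, (16 : ℤ) < ∑ q, ∑ i, signedSum q (N i) ^ 2 :=
        Finset.sum_lt_sum (fun q _ => hmin q) ⟨q, Finset.mem_univ q, by omega⟩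
      rw [Finset.sum_const, hcard, htot, nsmul_eq_mul] at this
      omega
    have hev : ∀ i j, Even (N i j) := fun i => even_of_four_dvd_signedSum fun q =>
      (of_not_balanceable_even (hbad q) ((hpar q).2 he) (hle q)).2 i
    rw [Finset.filter_false_of_mem fun q _ => Int.not_odd_iff_even.2 (hev q.1 q.2)] at hodd
    simp at hodd
  · have hodd' : ∀ q, Odd (∑ i, signedSum q (N i)) := fun q => by
      rw [← Int.not_even_iff_odd, hpar, Int.not_even_iff_odd]
      exact ho
    have hsq' : ∑ i, ∑ j, N i j ^ 2 ≤ 15 := by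
      have h₁ : Even (∑ i, ∑ j, N i j ^ 2) ↔ Even (∑ i, ∑ j, N i j) :=
        even_sum_iff_of_even_iff fun i _ => even_sum_iff_of_even_iff fun j _ => by
          simp [Int.even_pow]
      have h₂ : ¬ Even (∑ i, ∑ j, N i j ^ 2) := by
        rwa [h₁, Int.not_even_iff_odd]
      rw [Int.even_iff] at h₂
      omega
    obtain ⟨q₀, -, hq₀⟩ : ∃ q ∈ (Finset.univ : Finset (ℤˣ × ℤˣ × ℤˣ)),
        ∑ i, signedSum q (N i) ^ 2 ≤ 15 := by
      refine Finset.exists_le_of_sum_le Finset.univ_nonempty ?_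
      rw [Finset.sum_const, hcard, htot, nsmul_eq_mul]
      omega
    obtain ⟨i₀, hi₀, hne⟩ := exists_odd_of_not_balanceable (hbad q₀) (hodd' q₀) hq₀
    have hrow₀ : Odd (∑ j, N i₀ j) := by
      rwa [← Int.not_even_iff_odd, even_signedSum_iff, Int.not_even_iff_odd] at hi₀
    have hmin := fun q => of_not_balanceable_odd (i₀ := i₀) (hbad q)
      (by rwa [← Int.not_even_iff_odd, even_signedSum_iff, Int.not_even_iff_odd])
      (fun i hi => (even_signedSum_iff _ _).2 ((even_signedSum_iff _ _).1 (hne i hi)))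
    have hub : ∑ q, (8 * |signedSum q (N i₀)| +
        ∑ i ∈ Finset.univ.erase i₀, signedSum q (N i) ^ 2) ≤ 208 := by
      rw [Finset.sum_add_distrib, ← Finset.mul_sum, Finset.sum_comm]
      simp only [sum_signedSum_sq]
      rw [← Finset.mul_sum]
      have h₁ := sum_abs_signedSum_le (hN i₀) hrow₀
      have h₂ := Finset.add_sum_erase Finset.univ (fun i => ∑ j, N i j ^ 2) (Finset.mem_univ i₀)
      omega
    have hev : ∀ i, i ≠ i₀ → ∀ j, Even (N i j) := fun i hi =>
      even_of_four_dvd_signedSum fun q => (hmin q).2 (by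
        by_contra hge
        have h₁ := Finset.add_sum_erase Finset.univ (fun q => 8 * |signedSum q (N i₀)| +
          ∑ i ∈ Finset.univ.erase i₀, signedSum q (N i) ^ 2) (Finset.mem_univ q)
        have h₂ := Finset.card_nsmul_le_sum (Finset.univ.erase q) (fun q =>
          8 * |signedSum q (N i₀)| + ∑ i ∈ Finset.univ.erase i₀, signedSum q (N i) ^ 2) 24
          fun q _ => (hmin q).1
        rw [Finset.card_erase_of_mem (Finset.mem_univ q), hcard, nsmul_eq_mul] at h₂
        omega) i hi
    have hsub : (Finset.univ.filter fun q : Fin 4 × Fin 4 => Odd (N q.1 q.2)) ⊆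
        {i₀} ×ˢ Finset.univ := fun q hq => by
      simp only [Finset.mem_filter, Finset.mem_univ, true_and] at hq
      simp only [Finset.mem_product, Finset.mem_singleton, Finset.mem_univ, and_true]
      by_contra hi
      exact Int.not_odd_iff_even.2 (hev _ hi _) hq
    have := Finset.card_le_card hsub
    simp at this
    omega

/-- The sum of a line of lights after switching with a sign vector of product `δ`. For fixed `δ`
the four sign vectors are pairwise orthogonal. -/
def lineSum (δ s t : ℤˣ) (a : Fin 4 → ℤˣ) : ℤ := signedSum (s, t, δ * s * t) fun k => (a k : ℤ)

theorem lineSum_spec (δ s t : ℤˣ) (a : Fin 4 → ℤˣ) :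
    lineSum δ s t a = 2 * (lineSum δ s t a / 2) ∧ |lineSum δ s t a / 2| ≤ 2 ∧
      (Odd (lineSum δ s t a / 2) ↔ ∏ k, a k = -δ) := by
  have key : ∀ δ s t a b c d : ℤˣ,
      (a + s * b + t * c + (δ * s * t : ℤˣ) * d : ℤ) =
        2 * ((a + s * b + t * c + (δ * s * t : ℤˣ) * d : ℤ) / 2) ∧
      |(a + s * b + t * c + (δ * s * t : ℤˣ) * d : ℤ) / 2| ≤ 2 ∧
      ((a + s * b + t * c + (δ * s * t : ℤˣ) * d : ℤ) / 2 % 2 = 1 ↔ a * b * c * d = -δ) := by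
    decide +kernel
  simpa only [lineSum, signedSum_eq, Fin.prod_univ_four, Int.odd_iff] using
    key δ s t (a 0) (a 1) (a 2) (a 3)

theorem sum_lineSum_half_sq (δ : ℤˣ) (a : Fin 4 → ℤˣ) :
    ∑ p : ℤˣ × ℤˣ, (lineSum δ p.1 p.2 a / 2) ^ 2 = 4 := by
  have key : ∀ δ a b c d : ℤˣ, ∑ p : ℤˣ × ℤˣ,
      ((a + p.1 * b + p.2 * c + (δ * p.1 * p.2 : ℤˣ) * d : ℤ) / 2) ^ 2 = 4 := by
    decide +kernel
  simpa only [lineSum, signedSum_eq] using key δ (a 0) (a 1) (a 2) (a 3)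

/-- Some choice of `Z`-switches makes at least half of the halved line sums odd, while keeping their
mean square at most 1. -/
theorem exists_half_lineSums (A : LightCube 4) : ∃ δ s t : ℤˣ,
    8 ≤ (Finset.univ.filter fun q : Fin 4 × Fin 4 =>
      Odd (lineSum δ s t (A q.1 q.2) / 2)).card ∧
    ∑ i, ∑ j, (lineSum δ s t (A i j) / 2) ^ 2 ≤ 16 := by
  obtain ⟨δ, hδ⟩ : ∃ δ : ℤˣ, 8 ≤ (Finset.univ.filter fun q : Fin 4 × Fin 4 =>
      ∏ k, A q.1 q.2 k = -δ).card := by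
    have h := Finset.card_filter_add_card_filter_not (s := (Finset.univ : Finset (Fin 4 × Fin 4)))
      fun q => ∏ k, A q.1 q.2 k = 1
    have hneg : ∀ u : ℤˣ, ¬ u = 1 ↔ u = -1 := by decide
    simp only [hneg, Finset.card_univ, Fintype.card_prod, Fintype.card_fin] at h
    rcases le_total 8 (Finset.univ.filter fun q : Fin 4 × Fin 4 =>
      ∏ k, A q.1 q.2 k = 1).card with h₁ | h₁
    · exact ⟨-1, by simpa using h₁⟩
    · exact ⟨1, by omega⟩
  obtain ⟨p, -, hp⟩ : ∃ p ∈ (Finset.univ : Finset (ℤˣ × ℤˣ)),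
      ∑ i, ∑ j, (lineSum δ p.1 p.2 (A i j) / 2) ^ 2 ≤ 16 := by
    refine Finset.exists_le_of_sum_le Finset.univ_nonempty (le_of_eq ?_)
    rw [Finset.sum_comm]
    simp_rw [Finset.sum_comm (s := (Finset.univ : Finset (ℤˣ × ℤˣ))), sum_lineSum_half_sq]
    simp
  exact ⟨δ, p.1, p.2, by simpa only [(lineSum_spec δ p.1 p.2 _).2.2] using hδ, hp⟩

theorem alwaysReducible_four_four : AlwaysReducible 4 4 := by
  intro A
  obtain ⟨δ, s, t, hodd, hsq⟩ := exists_half_lineSums A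
  obtain ⟨p, q, hpq⟩ := exists_signs_abs_le_two (fun i j => lineSum δ s t (A i j) / 2)
    (fun i j => (lineSum_spec δ s t (A i j)).2.1) hodd hsq
  refine ⟨signs p, signs q, signs (s, t, δ * s * t), ?_⟩
  have h : (∑ i, ∑ j, ∑ k, (A.switch (signs p) (signs q) (signs (s, t, δ * s * t)) i j k : ℤ)) =
      2 * signedSum p fun i => signedSum q fun j => lineSum δ s t (A i j) / 2 := by
    have h₁ : ∀ i j, ∑ k, (signs (s, t, δ * s * t) k : ℤ) * A i j k =
        2 * (lineSum δ s t (A i j) / 2) := fun i j => (lineSum_spec δ s t (A i j)).1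
    simp only [signedSum, Finset.mul_sum]
    refine Finset.sum_congr rfl fun i _ => Finset.sum_congr rfl fun j _ => ?_
    rw [mul_left_comm, mul_left_comm 2, ← h₁, ← mul_assoc, Finset.mul_sum]
    refine Finset.sum_congr rfl fun k _ => ?_
    simp only [LightCube.switch, Units.val_mul]
    ring
  rw [imbalance_eq, h]
  have := abs_le.1 hpq
  omega

/-- Six lights, with exactly 0 or 2 of them in each plane, are off. -/
def sixOff : LightCube 4 := fun i j k =>
  if (i, j, k) ∈ ({(0, 0, 0), (0, 1, 1), (1, 1, 2), (1, 2, 0), (2, 2, 1), (2, 0, 2)} :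
    Finset (Fin 4 × Fin 4 × Fin 4)) then -1 else 1

theorem sum_switch_sixOff (x y z : Fin 4 → ℤˣ) :
    ∑ i, ∑ j, ∑ k, (sixOff.switch x y z i j k : ℤ) =
      (∑ i, (x i : ℤ)) * (∑ j, (y j : ℤ)) * (∑ k, (z k : ℤ)) -
        2 * (x 0 * y 0 * z 0 + x 0 * y 1 * z 1 + x 1 * y 1 * z 2 + x 1 * y 2 * z 0 +
          x 2 * y 2 * z 1 + x 2 * y 0 * z 2) := by
  simp [Fin.sum_univ_four, LightCube.switch, sixOff]
  ring

theorem sum_six_units_emod_four {a b c d e f : ℤˣ} (h : a * b * c * d * e * f = 1) :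
    (a + b + c + d + e + f : ℤ) % 4 = 2 := by
  revert a b c d e f
  decide +kernel

theorem two_dvd_sum_units (x : Fin 4 → ℤˣ) : (2 : ℤ) ∣ ∑ i, (x i : ℤ) := by
  have key : ∀ a b c d : ℤˣ, (2 : ℤ) ∣ a + b + c + d := by decide
  simpa [Fin.sum_univ_four] using key (x 0) (x 1) (x 2) (x 3)

theorem four_le_imbalance_switch_sixOff (x y z : Fin 4 → ℤˣ) :
    4 ≤ (sixOff.switch x y z).imbalance := by
  rw [imbalance_eq, sum_switch_sixOff]
  have h8 : (8 : ℤ) ∣ (∑ i, (x i : ℤ)) * (∑ j, (y j : ℤ)) * (∑ k, (z k : ℤ)) :=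
    mul_dvd_mul (mul_dvd_mul (two_dvd_sum_units x) (two_dvd_sum_units y)) (two_dvd_sum_units z)
  -- each of the nine switches of the six lights occurs in exactly two of them
  have hprod : (x 0 * y 0 * z 0) * (x 0 * y 1 * z 1) * (x 1 * y 1 * z 2) * (x 1 * y 2 * z 0) *
      (x 2 * y 2 * z 1) * (x 2 * y 0 * z 2) = 1 := by
    have h : (x 0 * y 0 * z 0) * (x 0 * y 1 * z 1) * (x 1 * y 1 * z 2) * (x 1 * y 2 * z 0) *
      (x 2 * y 2 * z 1) * (x 2 * y 0 * z 2) =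
      (x 0 * x 1 * x 2 * (y 0 * y 1 * y 2) * (z 0 * z 1 * z 2)) ^ 2 := by
      simp only [pow_two]
      ac_rfl
    rw [h, Int.units_sq]
  have h4 := sum_six_units_emod_four hprod
  push_cast at h4
  omega

end LightCube

theorem theorem3 : minThreshold 4 = 4 := by
  obtain ⟨hmem, hle⟩ := minThreshold_isLeast 4
  refine le_antisymm (hle LightCube.alwaysReducible_four_four) ?_
  obtain ⟨x, y, z, h⟩ := hmem LightCube.sixOff
  exact (LightCube.four_le_imbalance_switch_sixOff x y z).trans h
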